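/- **Setting.** Let $(K,\nu)$ be a valued field (valuations are written additively), let $\omega$ be an extension of $\nu$ to the rational function field $K(x)$ that is valuation transcendental, that is, the rational rank of $\omega K(x)/\nu K$ is $1$ or the residue field of $(K(x),\omega)$ has transcendence degree $1$ over that of $(K,\nu)$. Let $\overline{\nu}$ be an extension of $\nu$ to an algebraic closure $\overline K$ of $K$, and $\overline\omega$ a common extension of $\omega$ and $\overline\nu$ to $\overline K(x)$. **Definitions.** Let $\lambda$ be a limit ordinal. A sequence $(z_\mu)_{\mu<\lambda}$ in $K$ is *pseudo-Cauchy* if $\nu(z_{\mu_1}-z_{\mu_2})<\nu(z_{\mu_2}-z_{\mu_3})$ for all $\mu_1<\mu_2<\mu_3<\lambda$. An element $y$ of a valued extension of $(K,\nu)$ is a *limit* of it if the value of $y-z_\mu$ equals $\nu(z_\mu-z_{\mu+1})$ for all $\mu<\lambda$. The sequence is of *transcendental type* if $(\nu f(z_\mu))_{\mu<\lambda}$ is ultimately constant for every $f\in K[x]$, and of *algebraic type* otherwise. An *associated minimal polynomial* is a monic $m\in K[x]$ of minimal degree such that $(\nu m(z_\mu))_{\mu<\lambda}$ is ultimately strictly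 increasing. For $a\in\overline K$ and $\gamma$ in an ordered abelian group containing the value group of $\overline\nu$, let $\overline\nu_{a,\gamma}$ be the valuation of $\overline K(x)$ with $\overline\nu_{a,\gamma}\big(\sum_i c_i(x-a)^i\big)=\min_i(\overline\nu c_i+i\gamma)$ on polynomials. The pair $(a,\gamma)$ is a *pair of definition* for $\omega$ if $\overline\nu_{a,\gamma}$ is a common extension of $\omega$ and $\overline\nu$. It is a *minimal pair of definition* if moreover $[K(a):K]\le[K(b):K]$ for every $b\in\overline K$ with $\overline\nu(a-b)\ge\gamma$. For $f\in K[x]$ put $\delta(f)=\max\{\overline\omega(x-a)\mid a\in\overline K,\ f(a)=0\}$, and $\delta(f)=-\infty$ if $f$ is constant (including $f=0$). A root $a$ of a nonzero $f$ with $\overline\omega(x-a)=\delta(f)$ is a *maximal root* of $f$. A monic $Q\in K[x]$ is a *key polynomial* for $\omega$ if $\deg f<\deg Q$ implies $\delta(f)<\delta(Q)$ for all $f\in K[x]$. **Theorem 9.2.** Let $(z_\mu)_{\mu<\lambda}$ be a pseudo-Cauchy sequence in $(K,\nu)$ without a limit in $K$. Assume that $x$ is a limit of $(z_\mu)_{\mu<\lambda}$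 (with respect to $\omega$). Then: (i) $(z_\mu)_{\mu<\lambda}$ is of algebraic type. (ii) Whenever $(a,\gamma)$ is a pair of definition for $\omega$, $a$ is a limit of $(z_\mu)_{\mu<\lambda}$ (with respect to $\overline\nu$). (iii) If $Q\in K[x]$ is a nonlinear key polynomial for $\omega$ with a maximal root $b\in\overline K$, then $b$ is a limit of $(z_\mu)_{\mu<\lambda}$ (with respect to $\overline\nu$). (iv) Every associated minimal polynomial $m\in K[x]$ of $(z_\mu)_{\mu<\lambda}$ is a key polynomial for $\omega$. Conversely, if $(a,\gamma)$ is a minimal pair of definition for $\omega$ and $a$ is a limit of $(z_\mu)_{\mu<\lambda}$ (with respect to $\overline\nu$), then $x$ is a limit of $(z_\mu)_{\mu<\lambda}$ (with respect to $\omega$). -/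

import Mathlib

open Polynomial IntermediateField TensorProduct

noncomputable section

namespace ValTrans

/-! Valuations are written additively, with values in `WithTop Γ` for an ordered abelian group `Γ`,
so that `v x = ⊤` exactly when `x = 0`. -/

section Basic

variable {K L Γ : Type*} [Field K] [Field L] [Algebra K L]
  [AddCommGroup Γ] [LinearOrder Γ] [IsOrderedAddMonoid Γ]

/-- `w` extends `v` along the field extension `L | K`. -/
def Extends (v : AddValuation K (WithTop Γ)) (w : AddValuation L (WithTop Γ)) : Prop :=
  ∀ x : K, w (algebraMap K L x) = v x

/-- The value group `vK`, consisting of the values of the nonzero elements. -/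
def valueGroup (v : AddValuation K (WithTop Γ)) : AddSubgroup Γ where
  carrier := {g | ∃ x : K, v x = (g : WithTop Γ)}
  zero_mem' := ⟨1, by simp⟩
  add_mem' := by
    rintro a b ⟨x, hx⟩ ⟨y, hy⟩
    exact ⟨x * y, by rw [AddValuation.map_mul, hx, hy, WithTop.coe_add]⟩
  neg_mem' := by
    rintro a ⟨x, hx⟩
    refine ⟨x⁻¹, ?_⟩
    rw [AddValuation.map_inv, hx]
    rfl

/-- The rational rank of `wL / vK` is `1`. -/
def IsValueTranscendental (v : AddValuation K (WithTop Γ)) (w : AddValuation L (WithTop Γ)) :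
    Prop :=
  Module.rank ℚ (ℚ ⊗[ℤ] (valueGroup w ⧸ (valueGroup v).addSubgroupOf (valueGroup w))) = 1

/-- The residue field of `L` has transcendence degree `1` over the residue field of `K`. -/
def IsResidueTranscendental (v : AddValuation K (WithTop Γ)) (w : AddValuation L (WithTop Γ)) :
    Prop :=
  ∃ _ : (AddValuation.toValuation v).HasExtension (AddValuation.toValuation w),
    Algebra.trdeg (IsLocalRing.ResidueField (AddValuation.toValuation v).valuationSubring)
      (IsLocalRing.ResidueField (AddValuation.toValuation w).valuationSubring) = 1

def IsValuationTranscendental (v : AddValuation K (WithTop Γ)) (w : AddValuation L (WithTop Γ)) :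
    Prop :=
  IsValueTranscendental v w ∨ IsResidueTranscendental v w

/-! A sequence `(z_μ)_{μ < l}` is given by a function on all ordinals, of which only the values at
the ordinals `μ < l` are used. -/

def IsPseudoCauchy (v : AddValuation K (WithTop Γ)) (l : Ordinal) (z : Ordinal → K) : Prop :=
  Order.IsSuccLimit l ∧
    ∀ μ₁ μ₂ μ₃, μ₁ < μ₂ → μ₂ < μ₃ → μ₃ < l → v (z μ₁ - z μ₂) < v (z μ₂ - z μ₃)

/-- `y ∈ L` is a limit of the sequence `(z_μ)_{μ < l}` in `K`. -/
def IsLimit (v : AddValuation K (WithTop Γ)) (w : AddValuation L (WithTop Γ))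
    (l : Ordinal) (z : Ordinal → K) (y : L) : Prop :=
  ∀ μ < l, w (y - algebraMap K L (z μ)) = v (z μ - z (μ + 1))

def UltimatelyConstant (l : Ordinal) (g : Ordinal → WithTop Γ) : Prop :=
  ∃ μ₀ < l, ∀ μ, μ₀ ≤ μ → μ < l → g μ = g μ₀

def UltimatelyIncreasing (l : Ordinal) (g : Ordinal → WithTop Γ) : Prop :=
  ∃ μ₀ < l, ∀ μ₁ μ₂, μ₀ ≤ μ₁ → μ₁ < μ₂ → μ₂ < l → g μ₁ < g μ₂

def IsTranscendentalType (v : AddValuation K (WithTop Γ)) (l : Ordinal) (z : Ordinal → K) :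
    Prop :=
  ∀ f : K[X], UltimatelyConstant l fun μ => v (f.eval (z μ))

def IsAlgebraicType (v : AddValuation K (WithTop Γ)) (l : Ordinal) (z : Ordinal → K) : Prop :=
  ¬ IsTranscendentalType v l z

def IsAssociatedMinimalPolynomial (v : AddValuation K (WithTop Γ)) (l : Ordinal)
    (z : Ordinal → K) (m : K[X]) : Prop :=
  m.Monic ∧ (UltimatelyIncreasing l fun μ => v (m.eval (z μ))) ∧
    ∀ f : K[X], f.Monic → (UltimatelyIncreasing l fun μ => v (f.eval (z μ))) →
      m.degree ≤ f.degree

/-- The value `min_i (v c_i + i γ)` of the polynomial `f = ∑ c_i (x - a)^i`. -/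
def gaussValue (v : AddValuation K (WithTop Γ)) (a : K) (γ : Γ) (f : K[X]) : WithTop Γ :=
  (taylor a f).support.inf fun i => v ((taylor a f).coeff i) + ((i • γ : Γ) : WithTop Γ)

/-- `w` is the valuation of `K(x)` that is given on `K[x]` by `gaussValue v a γ`. -/
def IsGauss (v : AddValuation K (WithTop Γ)) (w : AddValuation (RatFunc K) (WithTop Γ))
    (a : K) (γ : Γ) : Prop :=
  ∀ f : K[X], w (algebraMap K[X] (RatFunc K) f) = gaussValue v a γ f

end Basic

section AlgClosure

variable {K Kbar Γ : Type*} [Field K] [Field Kbar] [Algebra K Kbar]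
  [AddCommGroup Γ] [LinearOrder Γ] [IsOrderedAddMonoid Γ]

/-- The inclusion of `K(x)` into `Kbar(x)`. -/
def ratFuncMap (K Kbar : Type*) [Field K] [Field Kbar] [Algebra K Kbar] :
    RatFunc K →+* RatFunc Kbar :=
  RatFunc.mapRingHom (Polynomial.mapRingHom (algebraMap K Kbar))
    (nonZeroDivisors_le_comap_nonZeroDivisors_of_injective _
      (Polynomial.map_injective _ (algebraMap K Kbar).injective))

/-- `wbar` is a common extension of `w` and `vbar` to `Kbar(x)`. -/
def IsCommonExtension (w : AddValuation (RatFunc K) (WithTop Γ))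
    (vbar : AddValuation Kbar (WithTop Γ)) (wbar : AddValuation (RatFunc Kbar) (WithTop Γ)) :
    Prop :=
  (∀ f : RatFunc K, wbar (ratFuncMap K Kbar f) = w f) ∧ Extends vbar wbar

/-- `(a, γ)` is a pair of definition for `w` (with respect to the fixed extension `vbar` of the
valuation of `K`): some common extension of `w` and `vbar` is given by `(a, γ)`. -/
def IsPairOfDefinition (w : AddValuation (RatFunc K) (WithTop Γ))
    (vbar : AddValuation Kbar (WithTop Γ)) (a : Kbar) (γ : Γ) : Prop :=
  ∃ wbar : AddValuation (RatFunc Kbar) (WithTop Γ),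
    IsCommonExtension w vbar wbar ∧ IsGauss vbar wbar a γ

def IsMinimalPairOfDefinition (w : AddValuation (RatFunc K) (WithTop Γ))
    (vbar : AddValuation Kbar (WithTop Γ)) (a : Kbar) (γ : Γ) : Prop :=
  IsPairOfDefinition w vbar a γ ∧
    ∀ b : Kbar, (γ : WithTop Γ) ≤ vbar (a - b) → Module.finrank K K⟮a⟯ ≤ Module.finrank K K⟮b⟯

/-- `δ(f)`, the maximum of `wbar (x - a)` over the roots `a` of `f` in `Kbar`. It is the bottom
element (that is, `-∞`) when `f` is a constant polynomial. -/
def delta (wbar : AddValuation (RatFunc Kbar) (WithTop Γ)) (f : K[X]) : WithBot (WithTop Γ) :=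
  open scoped Classical in
  (f.aroots Kbar).toFinset.sup fun a =>
    ((wbar (RatFunc.X - RatFunc.C a) : WithTop Γ) : WithBot (WithTop Γ))

def IsMaximalRoot (wbar : AddValuation (RatFunc Kbar) (WithTop Γ)) (f : K[X]) (a : Kbar) : Prop :=
  a ∈ f.aroots Kbar ∧
    delta wbar f = ((wbar (RatFunc.X - RatFunc.C a) : WithTop Γ) : WithBot (WithTop Γ))

def IsKeyPolynomial (wbar : AddValuation (RatFunc Kbar) (WithTop Γ)) (Q : K[X]) : Prop :=
  Q.Monic ∧ ∀ f : K[X], f.degree < Q.degree → delta wbar f < delta wbar Q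

end AlgClosure

end ValTrans

end

namespace ValTrans

/-! Put γ_μ = ω(x - z_μ), which is strictly increasing when x is a limit. By the ultrametric law, an
element b of the algebraic closure that is closer to x than every z_μ is a limit (`isLimit_of_lt`),
and a limit b is at least as close to x as every z_μ (`le_of_isLimit`). Parts (i)-(iv) amount to
locating such elements.

For (i), valuation transcendence makes some a closest to x (`exists_forall_le`). Otherwise every
nonzero element of K̄(x) has a leading term in K̄ (`hasApprox_ratFunc`), so values would be torsion
over νK and residues algebraic. A closest a beats every z_μ, and its minimal polynomial shows
algebraic type. For (ii), the centre of a pair of definition is closest to x; for (iii), Q is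
compared with the polynomials X - z_μ. For (iv), factoring over K̄ shows that ν f(z_μ) ultimately
increases exactly when f has a root that is a limit (`ultimatelyIncreasing_iff`), so polynomials of
degree below deg m have no such root.

For the converse, ω̄(x - z_μ) = min(γ, ν̄(a - z_μ)), and γ < ν̄(a - z_μ) would force a into K by
minimality. -/

theorem not_ultimatelyConstant_of_increasing {Γ : Type*} [LinearOrder Γ] {l : Ordinal}
    (hl : Order.IsSuccLimit l) {g : Ordinal → WithTop Γ}
    (hi : UltimatelyIncreasing l g) : ¬ UltimatelyConstant l g := by
  rintro ⟨μ₀, h₀, hc⟩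
  obtain ⟨μ₁, h₁, hi⟩ := hi
  have hm := max_lt h₀ h₁
  have := hi _ _ (le_max_right μ₀ μ₁) (Order.lt_add_one_iff.2 le_rfl) (hl.add_one_lt hm)
  rw [hc _ (le_max_left _ _) hm,
    hc _ ((le_max_left _ _).trans (Order.lt_add_one_iff.2 le_rfl).le) (hl.add_one_lt hm)] at this
  exact this.false

/-! ### Polynomial values along pseudo-Cauchy sequences -/

section Sequences

variable {K L Γ : Type*} [Field K] [Field L] [Algebra K L]
  [AddCommGroup Γ] [LinearOrder Γ] [IsOrderedAddMonoid Γ]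
  {v : AddValuation K (WithTop Γ)} {w : AddValuation L (WithTop Γ)}
  {l : Ordinal} {z : Ordinal → K}

theorem IsPseudoCauchy.lt (hz : IsPseudoCauchy v l z) {μ ν : Ordinal} (h : μ < ν) (hν : ν < l) :
    v (z μ - z (μ + 1)) < v (z ν - z (ν + 1)) := by
  have hν' : ν + 1 < l := hz.1.add_one_lt hν
  rcases (Order.add_one_le_of_lt h).eq_or_lt with rfl | h'
  · exact hz.2 _ _ _ (Order.lt_add_one_iff.2 le_rfl) (Order.lt_add_one_iff.2 le_rfl) hν'
  · exact (hz.2 μ (μ + 1) ν (Order.lt_add_one_iff.2 le_rfl) h' hν).trans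
      (hz.2 _ ν _ h' (Order.lt_add_one_iff.2 le_rfl) hν')

theorem IsPseudoCauchy.map_sub (hz : IsPseudoCauchy v l z) {μ ν : Ordinal} (h : μ < ν)
    (hν : ν < l) : v (z μ - z ν) = v (z μ - z (μ + 1)) := by
  rcases (Order.add_one_le_of_lt h).eq_or_lt with rfl | h'
  · rfl
  · have := hz.2 μ (μ + 1) ν (Order.lt_add_one_iff.2 le_rfl) h' hν
    rw [← sub_add_sub_cancel (z μ) (z (μ + 1)) (z ν), v.map_add_eq_of_lt_left this]

theorem IsPseudoCauchy.ne_top (hz : IsPseudoCauchy v l z) {μ : Ordinal} (h : μ < l) :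
    v (z μ - z (μ + 1)) ≠ ⊤ :=
  (hz.lt (Order.lt_add_one_iff.2 le_rfl) (hz.1.add_one_lt h)).ne_top

/-- The values at an element that is not a limit are ultimately constant. -/
theorem eventually_const_of_not_isLimit (hv : Extends v w) (hz : IsPseudoCauchy v l z) {y : L}
    (hy : ¬ IsLimit v w l z y) :
    ∃ g : Γ, ∃ μ₀ < l, ∀ μ, μ₀ ≤ μ → μ < l → w (algebraMap K L (z μ) - y) = g := by
  simp only [IsLimit, not_forall] at hy
  obtain ⟨ν, hν, hne⟩ := hy
  -- Where the limit condition fails, y - z_ν and z_ν - z_μ have distinct values, neither depending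
  -- on μ > ν.
  have key : ∀ μ, ν < μ → μ < l → w (algebraMap K L (z μ) - y) =
      min (w (y - algebraMap K L (z ν))) (v (z ν - z (ν + 1))) := by
    intro μ h hμ
    have e : w (algebraMap K L (z ν) - algebraMap K L (z μ)) = v (z ν - z (ν + 1)) := by
      rw [← RingHom.map_sub, hv, hz.map_sub h hμ]
    rw [w.map_sub_swap, ← e, ← w.map_add_of_distinct_val (by rwa [e]), sub_add_sub_cancel]
  -- The constant is finite, so adding it later preserves strict inequalities.
  obtain ⟨g, hg⟩ := WithTop.ne_top_iff_exists.1
    (min_lt_of_right_lt (hz.ne_top hν).lt_top :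
      min (w (y - algebraMap K L (z ν))) (v (z ν - z (ν + 1))) < ⊤).ne
  exact ⟨g, ν + 1, hz.1.add_one_lt hν, fun μ h hμ =>
    (key μ (Order.add_one_le_iff.1 h) hμ).trans hg.symm⟩

/-- For a finite product of factors `z μ - a`, the values are ultimately constant or ultimately
increasing, according to whether some `a` is a limit. -/
theorem eventually_prod (hv : Extends v w) (hz : IsPseudoCauchy v l z) (s : Multiset L) :
    ((∀ a ∈ s, ¬ IsLimit v w l z a) ∧ ∃ g : Γ, ∃ μ₀ < l, ∀ μ, μ₀ ≤ μ → μ < l →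
      w (s.map fun a => algebraMap K L (z μ) - a).prod = g) ∨
    ((∃ a ∈ s, IsLimit v w l z a) ∧
      UltimatelyIncreasing l fun μ => w (s.map fun a => algebraMap K L (z μ) - a).prod) := by
  induction s using Multiset.induction_on with
  | empty =>
    exact Or.inl ⟨by simp, 0, 0, hz.1.bot_lt, by simp⟩
  | cons a s ih =>
    simp only [UltimatelyIncreasing, Multiset.map_cons, Multiset.prod_cons, AddValuation.map_mul]
    by_cases ha : IsLimit v w l z a
    · right
      have inc : ∀ μ₁ μ₂, μ₁ < μ₂ → μ₂ < l →
          w (algebraMap K L (z μ₁) - a) < w (algebraMap K L (z μ₂) - a) := by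
        intro μ₁ μ₂ h h2
        rw [w.map_sub_swap, w.map_sub_swap _ a, ha _ (h.trans h2), ha _ h2]
        exact hz.lt h h2
      refine ⟨⟨a, by simp, ha⟩, ?_⟩
      rcases ih with ⟨-, g, μ₀, h₀, hg⟩ | ⟨-, μ₀, h₀, hg⟩
      · refine ⟨μ₀, h₀, fun μ₁ μ₂ h1 h2 h3 => ?_⟩
        rw [hg _ h1 (h2.trans h3), hg _ (h1.trans h2.le) h3]
        exact WithTop.add_lt_add_right WithTop.coe_ne_top (inc _ _ h2 h3)
      · exact ⟨μ₀, h₀, fun μ₁ μ₂ h1 h2 h3 =>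
          WithTop.add_lt_add (inc _ _ h2 h3) (hg _ _ h1 h2 h3)⟩
    · obtain ⟨g, μ₀, h₀, hg⟩ := eventually_const_of_not_isLimit hv hz ha
      rcases ih with ⟨hs, g', μ₁, h₁, hg'⟩ | ⟨⟨b, hb, hbl⟩, μ₁, h₁, hg'⟩
      · refine Or.inl ⟨by simpa [ha] using hs, g + g', max μ₀ μ₁, max_lt h₀ h₁, fun μ h hμ => ?_⟩
        rw [hg _ ((le_max_left _ _).trans h) hμ, hg' _ ((le_max_right _ _).trans h) hμ,
          WithTop.coe_add]
      · refine Or.inr ⟨⟨b, by simp [hb], hbl⟩, max μ₀ μ₁, max_lt h₀ h₁,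
          fun ν₁ ν₂ h1 h2 h3 => ?_⟩
        have h0 := (le_max_left _ _).trans h1
        rw [hg _ h0 (h2.trans h3), hg _ (h0.trans h2.le) h3]
        exact WithTop.add_lt_add_left WithTop.coe_ne_top
          (hg' _ _ ((le_max_right _ _).trans h1) h2 h3)

variable [IsAlgClosed L]

theorem map_eval_of_monic (hv : Extends v w) {f : K[X]} (hf : f.Monic) (c : K) :
    v (f.eval c) = w ((f.aroots L).map fun a => algebraMap K L c - a).prod := by
  rw [← hv, ← aeval_algebraMap_apply_eq_algebraMap_eval,
    (IsAlgClosed.splits _).aeval_eq_prod_aroots_of_monic hf]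

theorem ultimatelyIncreasing_iff (hv : Extends v w) (hz : IsPseudoCauchy v l z) {f : K[X]}
    (hf : f.Monic) : UltimatelyIncreasing l (fun μ => v (f.eval (z μ))) ↔
      ∃ a ∈ f.aroots L, IsLimit v w l z a := by
  simp only [map_eval_of_monic hv hf]
  rcases eventually_prod hv hz (f.aroots L) with ⟨h, g, μ₀, h₀, hg⟩ | ⟨h, h'⟩
  · refine iff_of_false (fun hi => ?_) (by simpa using h)
    refine not_ultimatelyConstant_of_increasing hz.1 hi ⟨μ₀, h₀, fun μ h1 h2 => ?_⟩
    exact (hg _ h1 h2).trans (hg _ le_rfl h₀).symm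
  · exact iff_of_true h' h

end Sequences

/-! ### Leading terms in the base field -/

section Immediate

variable {F L Γ : Type*} [Field F] [Field L] [Algebra F L]
  [AddCommGroup Γ] [LinearOrder Γ] [IsOrderedAddMonoid Γ]
  {w : AddValuation L (WithTop Γ)}

/-- `h` and some element of the base field have the same leading term. -/
def HasApprox (F : Type*) [Field F] [Algebra F L] (w : AddValuation L (WithTop Γ)) (h : L) :
    Prop :=
  ∃ c : F, w h < w (h - algebraMap F L c)

theorem HasApprox.mul {h h' : L} (H : HasApprox F w h) (H' : HasApprox F w h') :
    HasApprox F w (h * h') := by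
  obtain ⟨c, hc⟩ := H
  obtain ⟨c', hc'⟩ := H'
  refine ⟨c * c', ?_⟩
  have e : w (algebraMap F L c') = w h' :=
    w.map_eq_of_lt_sub (by rwa [w.map_sub_swap])
  have : h * h' - algebraMap F L (c * c') =
      h * (h' - algebraMap F L c') + (h - algebraMap F L c) * algebraMap F L c' := by
    rw [RingHom.map_mul]; ring
  rw [this]
  refine w.map_lt_add ?_ ?_
  · rw [w.map_mul, w.map_mul]
    exact WithTop.add_lt_add_left hc.ne_top hc'
  · rw [w.map_mul, w.map_mul, e]
    exact WithTop.add_lt_add_right hc'.ne_top hc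

theorem HasApprox.ne_zero {h : L} (H : HasApprox F w h) : h ≠ 0 := by
  rintro rfl
  obtain ⟨c, hc⟩ := H
  simp at hc

theorem HasApprox.inv {h : L} (H : HasApprox F w h) : HasApprox F w h⁻¹ := by
  have h0 := H.ne_zero
  obtain ⟨c, hc⟩ := H
  have e : w (algebraMap F L c) = w h :=
    w.map_eq_of_lt_sub (by rwa [w.map_sub_swap])
  have c0 : algebraMap F L c ≠ 0 := by
    rw [← w.ne_top_iff, e]; exact hc.ne_top
  refine ⟨c⁻¹, ?_⟩
  rw [show h⁻¹ - algebraMap F L c⁻¹ = (algebraMap F L c - h) * (h⁻¹ * (algebraMap F L c)⁻¹) by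
    rw [map_inv₀]; field_simp, w.map_mul, w.map_sub_swap, w.map_mul]
  have i1 : w h⁻¹ ≠ ⊤ := w.ne_top_iff.2 (inv_ne_zero h0)
  have i2 : w (algebraMap F L c)⁻¹ = w h⁻¹ := by rw [w.map_inv, w.map_inv, e]
  have i3 : w h + w h⁻¹ = 0 := by rw [← w.map_mul, mul_inv_cancel₀ h0, w.map_one]
  rw [i2]
  calc w h⁻¹ = w h + (w h⁻¹ + w h⁻¹) := by rw [← add_assoc, i3, zero_add]
    _ < _ := WithTop.add_lt_add_right (by simpa using i1) hc

theorem HasApprox.algebraMap {c : F} (hc : c ≠ 0) : HasApprox F w (algebraMap F L c) :=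
  ⟨c, by simpa [WithTop.lt_top_iff_ne_top] using hc⟩

/-- If no element of `F` is closest to `x`, every element of `F(x)` has an approximation in `F`. -/
theorem hasApprox_ratFunc [IsAlgClosed F] {w : AddValuation (RatFunc F) (WithTop Γ)}
    (H : ∀ a : F, ∃ b : F, w (RatFunc.X - RatFunc.C a) < w (RatFunc.X - RatFunc.C b))
    {h : RatFunc F} (h0 : h ≠ 0) : HasApprox F w h := by
  have lin : ∀ a : F, HasApprox F w (RatFunc.X - RatFunc.C a) := by
    intro a
    obtain ⟨b, hb⟩ := H a
    -- For b closer to x than a, the error (x - a) - (b - a) is x - b.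
    refine ⟨b - a, ?_⟩
    rwa [RatFunc.algebraMap_eq_C, RingHom.map_sub, sub_sub_sub_cancel_right]
  have pol : ∀ f : F[X], f ≠ 0 → HasApprox F w (algebraMap F[X] (RatFunc F) f) := by
    intro f hf
    rw [(IsAlgClosed.splits f).eq_prod_roots, RingHom.map_mul]
    refine .mul ?_ ?_
    · rw [RatFunc.algebraMap_C, ← RatFunc.algebraMap_eq_C]
      exact .algebraMap (leadingCoeff_ne_zero.2 hf)
    · induction f.roots using Multiset.induction_on with
      | empty => simpa using HasApprox.algebraMap (w := w) (one_ne_zero (α := F))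
      | cons a s ih =>
        rw [Multiset.map_cons, Multiset.prod_cons, RingHom.map_mul]
        refine .mul ?_ ih
        simpa using lin a
  rw [← RatFunc.num_div_denom h, div_eq_mul_inv]
  exact (pol _ (RatFunc.num_ne_zero h0)).mul (pol _ h.denom_ne_zero).inv

end Immediate

/-! ### Criteria against value and residue transcendence -/

/-- If every value of `w` is torsion modulo the value group of `v`, the rational rank is zero. -/
theorem not_isValueTranscendental {K L Γ : Type*} [Field K] [Field L]
    [AddCommGroup Γ] [LinearOrder Γ] [IsOrderedAddMonoid Γ]
    {v : AddValuation K (WithTop Γ)} {w : AddValuation L (WithTop Γ)}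
    (H : ∀ h : L, h ≠ 0 → ∃ n : ℕ, n ≠ 0 ∧ ∃ a : K, v a = n • w h) :
    ¬ IsValueTranscendental v w := by
  intro hr
  have : Subsingleton (ℚ ⊗[ℤ] (valueGroup w ⧸ (valueGroup v).addSubgroupOf (valueGroup w))) := by
    refine subsingleton_of_forall_eq 0 fun t => ?_
    induction t using TensorProduct.induction_on with
    | zero => rfl
    | add x y hx hy => rw [hx, hy, add_zero]
    | tmul q g =>
      obtain ⟨⟨g, h, hg⟩, rfl⟩ := QuotientAddGroup.mk_surjective g
      obtain ⟨n, n0, a, ha⟩ := H h (by rw [← w.ne_top_iff, hg]; exact WithTop.coe_ne_top)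
      have hn : (n : ℤ) • (QuotientAddGroup.mk ⟨g, h, hg⟩ :
          valueGroup w ⧸ (valueGroup v).addSubgroupOf (valueGroup w)) = 0 := by
        rw [natCast_zsmul, ← QuotientAddGroup.mk_nsmul, QuotientAddGroup.eq_zero_iff,
          AddSubgroup.mem_addSubgroupOf]
        exact ⟨a, by rw [ha, hg]; rfl⟩
      -- Divisibility of ℚ lets n move across the tensor sign, where it kills g.
      have hq : q = (n : ℤ) • (q / n) := by
        rw [zsmul_eq_mul, Int.cast_natCast, mul_div_cancel₀ _ (by exact_mod_cast n0)]
      rw [hq, TensorProduct.smul_tmul, hn, TensorProduct.tmul_zero]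
  rw [IsValueTranscendental, rank_subsingleton'] at hr
  exact zero_ne_one hr

section Algebraic

variable {K L Γ : Type*} [Field K] [Field L] [Algebra K L]
  [AddCommGroup Γ] [LinearOrder Γ] [IsOrderedAddMonoid Γ]
  {v : AddValuation K (WithTop Γ)} {w : AddValuation L (WithTop Γ)}

/-- The values of algebraic elements are torsion modulo the value group of the base field. -/
theorem exists_nsmul_eq_of_isAlgebraic (hv : Extends v w) {c : L} (hc : IsAlgebraic K c)
    (c0 : c ≠ 0) : ∃ n : ℕ, n ≠ 0 ∧ ∃ a : K, v a = n • w c := by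
  obtain ⟨p, p0, hp⟩ := hc
  let t : ℕ → L := fun i => algebraMap K L (p.coeff i) * c ^ i
  have ht : ∀ i ∈ p.support, w (t i) ≠ ⊤ := by
    intro i hi
    rw [w.ne_top_iff]
    exact mul_ne_zero (by simpa using hi) (pow_ne_zero _ c0)
  obtain ⟨i, hi, hmin⟩ := p.support.exists_min_image (fun i => w (t i)) (by simpa using p0)
  -- A unique term of least value would determine the value of the whole sum, which is 0.
  obtain ⟨j, hj, hji, hij⟩ : ∃ j ∈ p.support, j ≠ i ∧ w (t j) = w (t i) := by
    by_contra! hne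
    have hlt : w (t i) < w (∑ j ∈ p.support.erase i, t j) :=
      w.map_lt_sum (ht i hi) fun j hj => (hmin j (Finset.mem_of_mem_erase hj)).lt_of_ne'
        (hne j (Finset.mem_of_mem_erase hj) (Finset.ne_of_mem_erase hj))
    have hsum : t i + ∑ j ∈ p.support.erase i, t j = 0 := by
      rw [Finset.add_sum_erase _ _ hi, ← hp, aeval_def, eval₂_eq_sum, sum_def]
    have := w.map_add_eq_of_lt_left hlt
    rw [hsum, w.map_zero] at this
    exact ht i hi this.symm
  -- Equal values of the terms of degrees i < j give (j - i) w(c) = v(p_i / p_j).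
  have key : ∀ i j : ℕ, i < j → i ∈ p.support → j ∈ p.support → w (t j) = w (t i) →
      ∃ n : ℕ, n ≠ 0 ∧ ∃ a : K, v a = n • w c := by
    intro i j h hi hj e
    refine ⟨j - i, by omega, p.coeff i / p.coeff j, ?_⟩
    have a0 : algebraMap K L (p.coeff j) ≠ 0 := by simpa using hj
    have hb : algebraMap K L (p.coeff i / p.coeff j) = t i * (t j)⁻¹ * c ^ (j - i) := by
      obtain ⟨d, rfl⟩ := Nat.exists_eq_add_of_lt h
      simp only [t, map_div₀, show i + d + 1 - i = d + 1 by omega]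
      field_simp
      ring
    have tj0 : t j ≠ 0 := w.ne_top_iff.1 (ht j hj)
    rw [← hv, hb, w.map_mul, w.map_mul, ← e, ← w.map_mul, mul_inv_cancel₀ tj0, w.map_one,
      zero_add, w.map_pow]
  rcases lt_or_gt_of_ne hji with h | h
  · exact key j i h hj hi hij.symm
  · exact key i j h hi hj hij

/-- A root of a nonzero polynomial is a root of one whose coefficients are integral, one of them
being `1`. -/
theorem exists_primitive_of_isAlgebraic {c : L} (hc : IsAlgebraic K c) :
    ∃ p : K[X], (∀ i, 0 ≤ v (p.coeff i)) ∧ (∃ i, p.coeff i = 1) ∧ aeval c p = 0 := by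
  obtain ⟨p, p0, hp⟩ := hc
  obtain ⟨i, hi, hmin⟩ := p.support.exists_min_image (fun i => v (p.coeff i)) (by simpa using p0)
  have hi0 : p.coeff i ≠ 0 := by simpa using hi
  have key : v (p.coeff i)⁻¹ + v (p.coeff i) = 0 := by
    rw [← v.map_mul, inv_mul_cancel₀ hi0, v.map_one]
  -- Division by a coefficient of least value.
  refine ⟨C (p.coeff i)⁻¹ * p, fun j => ?_, ⟨i, by simp [hi0]⟩, by simp [hp]⟩
  rw [coeff_C_mul, v.map_mul, ← key]
  by_cases hj : p.coeff j = 0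
  · simp [hj]
  · gcongr
    exact hmin j (by simpa using hj)

theorem lt_map_pow_sub_pow {h c : L} (hh : 0 ≤ w h) (hc : 0 ≤ w c) (hlt : 0 < w (h - c)) (i : ℕ) :
    0 < w (h ^ i - c ^ i) := by
  induction i with
  | zero => simp
  | succ i ih =>
    rw [show h ^ (i + 1) - c ^ (i + 1) = h * (h ^ i - c ^ i) + (h - c) * c ^ i by ring]
    refine w.map_lt_add ?_ ?_
    · rw [w.map_mul]; exact ih.trans_le (le_add_of_nonneg_left hh)
    · rw [w.map_mul, w.map_pow]; exact hlt.trans_le (le_add_of_nonneg_right (nsmul_nonneg hc i))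

/-- Integral polynomials respect the congruence modulo the maximal ideal. -/
theorem lt_map_aeval_sub_aeval (hv : Extends v w) {p : K[X]} (hp : ∀ i, 0 ≤ v (p.coeff i))
    {h c : L} (hh : 0 ≤ w h) (hc : 0 ≤ w c) (hlt : 0 < w (h - c)) :
    0 < w (aeval h p - aeval c p) := by
  rw [aeval_eq_sum_range, aeval_eq_sum_range, ← Finset.sum_sub_distrib]
  refine w.map_lt_sum' (WithTop.coe_lt_top (0 : Γ)) fun i _ => ?_
  rw [← smul_sub, Algebra.smul_def, w.map_mul, hv]
  exact (lt_map_pow_sub_pow hh hc hlt i).trans_le (le_add_of_nonneg_left (hp i))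

/-- If integral elements satisfy integral primitive equations modulo the maximal ideal, the residue
field extension is algebraic. -/
theorem not_isResidueTranscendental
    (H : ∀ h : L, 0 ≤ w h → ∃ p : K[X], (∀ i, 0 ≤ v (p.coeff i)) ∧ (∃ i, p.coeff i = 1) ∧
      0 < w (aeval h p)) :
    ¬ IsResidueTranscendental v w := by
  rintro ⟨_, htr⟩
  -- `toValuation` reverses the order, so membership in the valuation ring unfolds to nonnegativity.
  have mem : ∀ x : L, x ∈ (AddValuation.toValuation w).valuationSubring ↔ 0 ≤ w x :=
    fun _ => Iff.rfl
  have memv : ∀ x : K, x ∈ (AddValuation.toValuation v).valuationSubring ↔ 0 ≤ v x :=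
    fun _ => Iff.rfl
  have alg : Algebra.IsAlgebraic
      (IsLocalRing.ResidueField (AddValuation.toValuation v).valuationSubring)
      (IsLocalRing.ResidueField (AddValuation.toValuation w).valuationSubring) := by
    refine ⟨fun x => ?_⟩
    obtain ⟨⟨h, hh⟩, rfl⟩ := IsLocalRing.residue_surjective x
    obtain ⟨p, hp, ⟨i, hi⟩, hlt⟩ := H h ((mem h).1 hh)
    have hl : p ∈ lifts (AddValuation.toValuation v).valuationSubring.subtype :=
      (lifts_iff_coeff_lifts p).2 fun i => ⟨⟨p.coeff i, (memv _).2 (hp i)⟩, rfl⟩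
    obtain ⟨q, rfl⟩ := (mem_lifts _).1 hl
    -- The coefficient 1 keeps the reduction nonzero; the positive value at h makes the residue of h
    -- a root.
    refine ⟨q.map (IsLocalRing.residue _), fun h0 => ?_, ?_⟩
    · have := congrArg (coeff · i) h0
      have hqi : q.coeff i = 1 := Subtype.ext (by simpa using hi)
      simp [hqi] at this
    · have e1 : aeval (IsLocalRing.residue _ (⟨h, hh⟩ :
          (AddValuation.toValuation w).valuationSubring)) (q.map (IsLocalRing.residue _)) =
          IsLocalRing.residue _ (aeval (⟨h, hh⟩ :
            (AddValuation.toValuation w).valuationSubring) q) := by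
        rw [aeval_def, aeval_def, eval₂_map, hom_eval₂]
        rfl
      have e2 : ((aeval (⟨h, hh⟩ : (AddValuation.toValuation w).valuationSubring) q :
          (AddValuation.toValuation w).valuationSubring) : L) =
          aeval h (q.map (AddValuation.toValuation v).valuationSubring.subtype) := by
        rw [aeval_def, aeval_def, eval₂_map]
        exact hom_eval₂ q _ (AddValuation.toValuation w).valuationSubring.subtype _
      rw [e1, IsLocalRing.residue_eq_zero_iff, IsLocalRing.mem_maximalIdeal, mem_nonunits_iff]
      intro hu
      obtain ⟨y, hy⟩ := hu.exists_right_inv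
      have hy' := congrArg Subtype.val hy
      rw [MulMemClass.coe_mul, e2] at hy'
      have := congrArg w hy'
      rw [w.map_mul] at this
      have hpos := hlt.trans_le (le_add_of_nonneg_right ((mem _).1 y.2))
      rw [this] at hpos
      exact hpos.ne' w.map_one
  rw [trdeg_eq_zero] at htr
  exact zero_ne_one htr

end Algebraic

/-! ### Distance to x and limits in the algebraic closure -/

section AlgClosure

variable {K Kbar Γ : Type*} [Field K] [Field Kbar] [Algebra K Kbar]
  [AddCommGroup Γ] [LinearOrder Γ] [IsOrderedAddMonoid Γ]
  {v : AddValuation K (WithTop Γ)} {w : AddValuation (RatFunc K) (WithTop Γ)}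
  {vbar : AddValuation Kbar (WithTop Γ)} {wbar : AddValuation (RatFunc Kbar) (WithTop Γ)}
  {l : Ordinal} {z : Ordinal → K}

theorem ratFuncMap_algebraMap (f : K[X]) :
    ratFuncMap K Kbar (algebraMap K[X] (RatFunc K) f) =
      algebraMap Kbar[X] (RatFunc Kbar) (f.map (algebraMap K Kbar)) := by
  simp [ratFuncMap, RatFunc.mapRingHom, RatFunc.map_apply]

theorem ratFuncMap_C (c : K) :
    ratFuncMap K Kbar (RatFunc.C c) = RatFunc.C (algebraMap K Kbar c) := by
  rw [← RatFunc.algebraMap_C, ratFuncMap_algebraMap, map_C, RatFunc.algebraMap_C]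

theorem ratFuncMap_X : ratFuncMap K Kbar RatFunc.X = RatFunc.X := by
  rw [← RatFunc.algebraMap_X, ratFuncMap_algebraMap, map_X, RatFunc.algebraMap_X]

theorem IsCommonExtension.map_X_sub_C (h : IsCommonExtension w vbar wbar) (c : K) :
    wbar (RatFunc.X - RatFunc.C (algebraMap K Kbar c)) = w (RatFunc.X - RatFunc.C c) := by
  rw [← h.1, RingHom.map_sub, ratFuncMap_C, ratFuncMap_X]

theorem Extends.map_C {w : AddValuation (RatFunc K) (WithTop Γ)} (h : Extends v w) (c : K) :
    w (RatFunc.C c) = v c := by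
  rw [← h, RatFunc.algebraMap_eq_C]

/-- In b - z_μ = (x - z_μ) - (x - b), the first term has the smaller value. -/
theorem isLimit_of_lt (h : IsCommonExtension w vbar wbar)
    (hx : IsLimit v w l z RatFunc.X) {b : Kbar}
    (hb : ∀ μ < l, w (RatFunc.X - RatFunc.C (z μ)) < wbar (RatFunc.X - RatFunc.C b)) :
    IsLimit v vbar l z b := by
  intro μ hμ
  have hlt := hb μ hμ
  rw [← h.map_X_sub_C] at hlt
  rw [← hx μ hμ, RatFunc.algebraMap_eq_C, ← h.map_X_sub_C, ← wbar.map_sub_eq_of_lt_left hlt,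
    sub_sub_sub_cancel_left, ← RingHom.map_sub, h.2.map_C]

/-- The inequality is strict because z_(μ+1) is already closer to x than z_μ. -/
theorem lt_of_forall_le (hz : IsPseudoCauchy v l z) (h : IsCommonExtension w vbar wbar)
    (hx : IsLimit v w l z RatFunc.X) {a : Kbar}
    (ha : ∀ b : K, wbar (RatFunc.X - RatFunc.C (algebraMap K Kbar b)) ≤
      wbar (RatFunc.X - RatFunc.C a)) :
    ∀ μ < l, w (RatFunc.X - RatFunc.C (z μ)) < wbar (RatFunc.X - RatFunc.C a) := by
  intro μ hμ
  have h1 := hz.lt (Order.lt_add_one_iff.2 (le_refl μ)) (hz.1.add_one_lt hμ)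
  rw [← hx μ hμ, ← hx _ (hz.1.add_one_lt hμ), RatFunc.algebraMap_eq_C] at h1
  exact h1.trans_le ((h.map_X_sub_C _).symm.le.trans (ha _))

/-- Both x - z_μ and a - z_μ have the same value, which bounds that of their difference from below.
-/
theorem le_of_isLimit (h : IsCommonExtension w vbar wbar)
    (hx : IsLimit v w l z RatFunc.X) {a : Kbar} (ha : IsLimit v vbar l z a) {μ : Ordinal}
    (hμ : μ < l) : w (RatFunc.X - RatFunc.C (z μ)) ≤ wbar (RatFunc.X - RatFunc.C a) := by
  have h1 : wbar (RatFunc.C a - RatFunc.C (algebraMap K Kbar (z μ))) =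
      w (RatFunc.X - RatFunc.C (z μ)) := by
    rw [← RingHom.map_sub, h.2.map_C, ha μ hμ, ← hx μ hμ, RatFunc.algebraMap_eq_C]
  rw [← sub_sub_sub_cancel_right _ _ (RatFunc.C (algebraMap K Kbar (z μ)))]
  exact wbar.map_le_sub (h.map_X_sub_C _).ge h1.ge

/-- The terms of x - b = (x - a) + (a - b) have values γ and ν̄(a - b). In particular no b is closer
to x than a. -/
theorem IsGauss.map_X_sub_C {a : Kbar} {γ : Γ} (h : IsGauss vbar wbar a γ) (b : Kbar) :
    wbar (RatFunc.X - RatFunc.C b) = min (γ : WithTop Γ) (vbar (a - b)) := by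
  have ht : taylor a (X - C b) = X + C (a - b) := by
    rw [map_sub, taylor_X, taylor_C, C_sub, add_sub_assoc]
  have hf := h (X - C b)
  rw [gaussValue, ht, map_sub, RatFunc.algebraMap_X, RatFunc.algebraMap_C] at hf
  rw [hf]
  refine le_antisymm (le_min ?_ ?_) (Finset.le_inf fun i hi => ?_)
  · refine (Finset.inf_le (b := 1) (by simp)).trans (by simp)
  · by_cases hab : a - b = 0
    · simp [hab]
    · exact (Finset.inf_le (b := 0) (by simpa using hab)).trans (by simp)
  · have hi2 := le_natDegree_of_mem_supp i hi
    rw [natDegree_X_add_C] at hi2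
    interval_cases i
    · simp
    · simp

/-- A valuation transcendental extension attains the maximum of the values of `x - a`. -/
theorem exists_forall_le [IsAlgClosure K Kbar] (hv : Extends v vbar)
    (h : IsCommonExtension w vbar wbar) (htr : IsValuationTranscendental v w) :
    ∃ a : Kbar, ∀ b : Kbar, wbar (RatFunc.X - RatFunc.C b) ≤ wbar (RatFunc.X - RatFunc.C a) := by
  by_contra! H
  have := IsAlgClosure.isAlgClosed K (K := Kbar)
  have := IsAlgClosure.isAlgebraic (R := K) (K := Kbar)
  -- Without a closest element, each nonzero f has the value of its leading term c, which is
  -- algebraic over K.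
  have app : ∀ f : RatFunc K, f ≠ 0 → ∃ c : Kbar, vbar c = w f ∧
      w f < wbar (ratFuncMap K Kbar f - RatFunc.C c) := by
    intro f f0
    obtain ⟨c, hc⟩ := hasApprox_ratFunc H ((map_ne_zero (ratFuncMap K Kbar)).2 f0)
    rw [h.1, RatFunc.algebraMap_eq_C] at hc
    refine ⟨c, ?_, hc⟩
    rw [← h.2.map_C, ← h.1 f]
    exact wbar.map_eq_of_lt_sub (by rwa [wbar.map_sub_swap, h.1])
  rcases htr with htr | htr
  · refine not_isValueTranscendental (fun f f0 => ?_) htr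
    obtain ⟨c, hc, -⟩ := app f f0
    rw [← hc]
    refine exists_nsmul_eq_of_isAlgebraic hv (Algebra.IsAlgebraic.isAlgebraic c) ?_
    rw [← vbar.ne_top_iff, hc, w.ne_top_iff]
    exact f0
  · refine not_isResidueTranscendental (fun f hf => ?_) htr
    by_cases f0 : f = 0
    · exact ⟨X, fun i => by by_cases hi : 1 = i <;> simp [coeff_X, hi], ⟨1, by simp⟩, by simp [f0]⟩
    obtain ⟨c, hc, hlt⟩ := app f f0
    obtain ⟨p, hp, hi, hpc⟩ :=
      exists_primitive_of_isAlgebraic (v := v) (Algebra.IsAlgebraic.isAlgebraic (R := K) c)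
    refine ⟨p, hp, hi, ?_⟩
    have hq : ∀ i, 0 ≤ vbar ((p.map (algebraMap K Kbar)).coeff i) := fun i => by
      rw [coeff_map, hv]; exact hp i
    have e1 : aeval (ratFuncMap K Kbar f) (p.map (algebraMap K Kbar)) =
        ratFuncMap K Kbar (aeval f p) := by
      rw [aeval_def, aeval_def, eval₂_map, hom_eval₂]
      congr 1
      ext c
      simp [RatFunc.algebraMap_eq_C, ratFuncMap_C]
    have e2 : aeval (RatFunc.C c) (p.map (algebraMap K Kbar)) = 0 := by
      rw [← RatFunc.algebraMap_eq_C, aeval_algebraMap_apply, aeval_map_algebraMap, hpc, map_zero]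
    -- Since f and c are congruent modulo the maximal ideal, the primitive equation of c holds for f
    -- up to positive value.
    have := lt_map_aeval_sub_aeval h.2 hq (h := ratFuncMap K Kbar f) (c := RatFunc.C c)
      (by rwa [h.1]) (by rwa [h.2.map_C, hc]) (hf.trans_lt hlt)
    rwa [e1, e2, sub_zero, h.1] at this

end AlgClosure

/-! ### The assertions of the theorem -/

section Main

variable {K Kbar Γ : Type*} [Field K] [Field Kbar] [Algebra K Kbar]
  [AddCommGroup Γ] [LinearOrder Γ] [IsOrderedAddMonoid Γ]
  {v : AddValuation K (WithTop Γ)} {w : AddValuation (RatFunc K) (WithTop Γ)}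
  {vbar : AddValuation Kbar (WithTop Γ)} {wbar : AddValuation (RatFunc Kbar) (WithTop Γ)}
  {l : Ordinal} {z : Ordinal → K}

theorem isAlgebraicType_of_isLimit [IsAlgClosure K Kbar] (hv : Extends v vbar)
    (hz : IsPseudoCauchy v l z) {a : Kbar} (ha : IsLimit v vbar l z a) :
    IsAlgebraicType v l z := by
  have := IsAlgClosure.isAlgClosed K (K := Kbar)
  have := IsAlgClosure.isAlgebraic (R := K) (K := Kbar)
  have hi := Algebra.IsIntegral.isIntegral (R := K) a
  intro h
  refine not_ultimatelyConstant_of_increasing hz.1 ((ultimatelyIncreasing_iff hv hz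
    (minpoly.monic hi)).2 ⟨a, ?_, ha⟩) (h _)
  exact mem_aroots.2 ⟨minpoly.ne_zero hi, minpoly.aeval K a⟩

theorem IsPairOfDefinition.isLimit (hz : IsPseudoCauchy v l z)
    (hx : IsLimit v w l z RatFunc.X) {a : Kbar} {γ : Γ} (h : IsPairOfDefinition w vbar a γ) :
    IsLimit v vbar l z a := by
  obtain ⟨wbar, h, hg⟩ := h
  refine isLimit_of_lt h hx (lt_of_forall_le hz h hx fun b => ?_)
  rw [hg.map_X_sub_C, hg.map_X_sub_C, sub_self, vbar.map_zero, min_eq_left le_top]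
  exact min_le_left _ _

theorem IsKeyPolynomial.isLimit_maximalRoot (h : IsCommonExtension w vbar wbar)
    (hx : IsLimit v w l z RatFunc.X) {Q : K[X]} (hQ : IsKeyPolynomial wbar Q)
    (hdeg : Q.natDegree ≠ 1) {b : Kbar} (hb : IsMaximalRoot wbar Q b) : IsLimit v vbar l z b := by
  classical
  refine isLimit_of_lt h hx fun μ _ => ?_
  -- A constant has no root; with degree 1 excluded, X - z_μ has smaller degree than Q.
  have h0 : Q.natDegree ≠ 0 := by
    intro h0
    have := hb.1
    rw [hQ.1.natDegree_eq_zero.1 h0] at this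
    simp at this
  have h1 := hQ.2 (X - C (z μ)) (by
    rw [degree_X_sub_C, degree_eq_natDegree hQ.1.ne_zero]
    exact_mod_cast (by omega : 1 < Q.natDegree))
  rw [hb.2, delta, aroots_X_sub_C, Multiset.toFinset_singleton, Finset.sup_singleton,
    h.map_X_sub_C] at h1
  exact WithBot.coe_lt_coe.1 h1

theorem IsAssociatedMinimalPolynomial.isKeyPolynomial [IsAlgClosed Kbar] (hv : Extends v vbar)
    (hz : IsPseudoCauchy v l z) (h : IsCommonExtension w vbar wbar)
    (hx : IsLimit v w l z RatFunc.X) {m : K[X]} (hm : IsAssociatedMinimalPolynomial v l z m) :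
    IsKeyPolynomial wbar m := by
  classical
  obtain ⟨mon, inc, hmin⟩ := hm
  obtain ⟨b, hb, hbl⟩ := (ultimatelyIncreasing_iff hv hz mon).1 inc
  refine ⟨mon, fun f hf => ?_⟩
  have hδ : ((wbar (RatFunc.X - RatFunc.C b) : WithTop Γ) : WithBot (WithTop Γ)) ≤ delta wbar m :=
    Finset.le_sup (f := fun a => ((wbar (RatFunc.X - RatFunc.C a) : WithTop Γ) :
      WithBot (WithTop Γ))) (Multiset.mem_toFinset.2 hb)
  refine lt_of_lt_of_le ?_ hδ
  -- The bottom value covers an f without roots, in particular f constant or zero.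
  refine (Finset.sup_lt_iff (WithBot.bot_lt_coe _)).2 fun a ha => WithBot.coe_lt_coe.2 ?_
  have ha' := Multiset.mem_toFinset.1 ha
  have f0 : f ≠ 0 := by rintro rfl; simp at ha'
  have hal : ¬ IsLimit v vbar l z a := by
    intro hal
    have monic := monic_mul_leadingCoeff_inv f0
    have h1 := hmin _ monic ((ultimatelyIncreasing_iff hv hz monic).2 ⟨a,
      mem_aroots.2 ⟨monic.ne_zero, by simp [(mem_aroots.1 ha').2]⟩, hal⟩)
    rw [degree_mul_leadingCoeff_inv f f0] at h1
    exact h1.not_gt hf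
  -- A root a that is not a limit is no closer to x than some z_μ, while b is at least as close as
  -- z_(μ+1).
  obtain ⟨μ, hμ, hle⟩ : ∃ μ < l, wbar (RatFunc.X - RatFunc.C a) ≤
      w (RatFunc.X - RatFunc.C (z μ)) := by
    by_contra! hlt
    exact hal (isLimit_of_lt h hx hlt)
  have hμ' := hz.1.add_one_lt hμ
  have h1 := hz.lt (Order.lt_add_one_iff.2 (le_refl μ)) hμ'
  rw [← hx μ hμ, ← hx _ hμ', RatFunc.algebraMap_eq_C] at h1
  exact hle.trans_lt (h1.trans_le (le_of_isLimit h hx hbl hμ'))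

theorem IsMinimalPairOfDefinition.isLimit_X [Algebra.IsAlgebraic K Kbar] (hv : Extends v vbar)
    (hlim : ∀ c : K, ¬ IsLimit v v l z c) {a : Kbar} {γ : Γ}
    (h : IsMinimalPairOfDefinition w vbar a γ) (ha : IsLimit v vbar l z a) :
    IsLimit v w l z RatFunc.X := by
  obtain ⟨⟨wbar, h, hg⟩, hmin⟩ := h
  intro μ hμ
  rw [RatFunc.algebraMap_eq_C, ← h.map_X_sub_C, hg.map_X_sub_C, ha μ hμ]
  -- If γ were smaller, z_μ would compete with a in the minimality condition, so [K(a):K] ≤ 1 and a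
  -- would be a limit in K.
  refine min_eq_right (le_of_not_gt fun hlt => ?_)
  have hfin := hmin (algebraMap K Kbar (z μ)) (by rw [ha μ hμ]; exact hlt.le)
  -- This excludes the default value 0 of `Module.finrank`.
  have : FiniteDimensional K K⟮a⟯ :=
    adjoin.finiteDimensional (Algebra.IsIntegral.isIntegral a)
  rw [finrank_adjoin_simple_eq_one_iff.2 (IntermediateField.algebraMap_mem _ _)] at hfin
  obtain ⟨c, rfl⟩ := mem_bot.1 (finrank_adjoin_simple_eq_one_iff.1
    (le_antisymm hfin (Module.finrank_pos (R := K) (M := K⟮a⟯))))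
  refine hlim c fun ν hν => ?_
  rw [← ha ν hν, ← RingHom.map_sub, hv]
  rfl

end Main

end ValTrans

theorem theorem9p2 {K Kbar Γ : Type*} [Field K] [Field Kbar] [Algebra K Kbar]
    [IsAlgClosure K Kbar] [AddCommGroup Γ] [LinearOrder Γ] [IsOrderedAddMonoid Γ]
    (v : AddValuation K (WithTop Γ)) (w : AddValuation (RatFunc K) (WithTop Γ))
    (vbar : AddValuation Kbar (WithTop Γ)) (wbar : AddValuation (RatFunc Kbar) (WithTop Γ))
    (hw : ValTrans.Extends v w) (hvbar : ValTrans.Extends v vbar)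
    (hwbar : ValTrans.IsCommonExtension w vbar wbar)
    (htr : ValTrans.IsValuationTranscendental v w)
    (l : Ordinal) (z : Ordinal → K) (hz : ValTrans.IsPseudoCauchy v l z)
    (hlim : ∀ c : K, ¬ ValTrans.IsLimit v v l z c) :
    (ValTrans.IsLimit v w l z RatFunc.X →
      ValTrans.IsAlgebraicType v l z ∧
      (∀ (a : Kbar) (γ : Γ), ValTrans.IsPairOfDefinition w vbar a γ →
        ValTrans.IsLimit v vbar l z a) ∧
      (∀ (Q : Polynomial K) (b : Kbar), ValTrans.IsKeyPolynomial wbar Q → Q.natDegree ≠ 1 →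
        ValTrans.IsMaximalRoot wbar Q b → ValTrans.IsLimit v vbar l z b) ∧
      (∀ m : Polynomial K, ValTrans.IsAssociatedMinimalPolynomial v l z m →
        ValTrans.IsKeyPolynomial wbar m)) ∧
    (∀ (a : Kbar) (γ : Γ), ValTrans.IsMinimalPairOfDefinition w vbar a γ →
      ValTrans.IsLimit v vbar l z a → ValTrans.IsLimit v w l z RatFunc.X) := by
  have := IsAlgClosure.isAlgClosed K (K := Kbar)
  have := IsAlgClosure.isAlgebraic (R := K) (K := Kbar)
  refine ⟨fun hx => ⟨?_, fun a γ h => h.isLimit hz hx,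
    fun Q b hQ hdeg hb => hQ.isLimit_maximalRoot hwbar hx hdeg hb,
    fun m hm => hm.isKeyPolynomial hvbar hz hwbar hx⟩, fun a γ h ha => h.isLimit_X hvbar hlim ha⟩
  obtain ⟨a, ha⟩ := ValTrans.exists_forall_le hvbar hwbar htr
  exact ValTrans.isAlgebraicType_of_isLimit hvbar hz (ValTrans.isLimit_of_lt hwbar hx
    (ValTrans.lt_of_forall_le hz hwbar hx fun b => ha _))
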